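/- An $n$-bit partial Boolean function is a map $f:\mathrm{Dom}(f)\to\{0,1\}$ with $\mathrm{Dom}(f)\subseteq\{0,1\}^n$. A randomized (query) algorithm is a probability distribution over deterministic decision trees, which query one input symbol at a time. Let $P_f\subseteq\{0,1,*\}^n$ be the set of all strings $p$ for which there are $x,y\in\mathrm{Dom}(f)$ with $f(x)\neq f(y)$ and $x_i=y_i=p_i$ whenever $p_i\neq *$, and let $P_f^\dagger\subseteq\{0,1,\dagger\}^n$ be defined in the same way with the symbol $\dagger$ in place of $*$. The sabotage problem $f_{\mathrm{sab}}:P_f\cup P_f^\dagger\to\{0,1\}$ takes the value $0$ on $P_f$ and $1$ on $P_f^\dagger$. The randomized sabotage complexity of $f$ is $\mathrm{RS}(f):=\mathrm{R}_0(f_{\mathrm{sab}})$, where $\mathrm{R}_0(h)$ is the zero-error expected randomized query complexity of a partial function $h$: the minimum, over all randomized algorithms that output $h(x)$ with probability $1$ on every $x\in\mathrm{Dom}(h)$, of the maximum over $x\in\mathrm{Dom}(h)$ of the expected number of queries on $x$ (the maximum over an empty domain is $0$). Let $\mathrm{R}(f)$ be the bounded-error randomized query complexity of $f$: the minimum, over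 all randomized algorithms that output $f(x)$ with probability at least $2/3$ on every $x\in\mathrm{Dom}(f)$, of the maximum number of queries made by any decision tree in the support of the algorithm on any $x\in\mathrm{Dom}(f)$. For an $n$-bit partial function $f$ and an $m$-bit partial function $g$, the composition $f\circ g$ is the $nm$-bit partial function $(x_1,\dots,x_n)\mapsto f(g(x_1),\dots,g(x_n))$, defined when every $x_i\in\mathrm{Dom}(g)$ and $(g(x_1),\dots,g(x_n))\in\mathrm{Dom}(f)$. Write $f^1=f$ and $f^{k+1}=f\circ f^k$. Then for all partial Boolean functions $f$ and $g$, $$\mathrm{RS}(f\circ g)\ \geq\ \mathrm{RS}(f)\,\mathrm{RS}(g),$$ and for every partial Boolean function $f$ and every integer $k\geq 1$, $$\mathrm{R}(f^k)\ \geq\ \frac{\mathrm{RS}(f)^k}{3}.$$ -/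

import Mathlib

open scoped ENNReal

noncomputable section

namespace Sabotage

universe u v w

/-- Partial functions with Boolean output whose inputs are strings over the alphabet `X` with
positions indexed by `ι`; `(f x).Dom` says that `x` is in the domain of `f`, and `b ∈ f x` that
moreover `f x = b`. An `n`-bit partial Boolean function is the case `X = Bool` and `ι` a
set of `n` elements. -/
abbrev PartialFn (X : Type u) (ι : Type v) : Type (max u v) := (ι → X) → Part Bool

/-- Deterministic query algorithms (decision trees). A node queries one position and branches on
the symbol that is read; a leaf gives the output. -/
inductive DecTree (X : Type u) (ι : Type v) : Type (max u v)
  | leaf (b : Bool) : DecTree X ι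
  | query (i : ι) (next : X → DecTree X ι) : DecTree X ι

namespace DecTree

variable {X : Type u} {ι : Type v}

/-- The output of a decision tree on the input `x`. -/
def eval : DecTree X ι → (ι → X) → Bool
  | leaf b, _ => b
  | query i next, x => eval (next (x i)) x

/-- The number of queries that a decision tree makes on the input `x`. -/
def cost : DecTree X ι → (ι → X) → ℕ
  | leaf _, _ => 0
  | query i next, x => cost (next (x i)) x + 1

end DecTree

/-- A randomized query algorithm is a probability distribution over deterministic ones. -/
abbrev RandAlg (X : Type u) (ι : Type v) : Type (max u v) := PMF (DecTree X ι)

section Complexity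

variable {X : Type u} {ι : Type v}

/-- The expected number of queries that `A` makes on the input `x`. -/
def RandAlg.expCost (A : RandAlg X ι) (x : ι → X) : ℝ≥0∞ :=
  ∑' T : DecTree X ι, A T * (T.cost x : ℝ≥0∞)

/-- `A` computes `f` with error at most `ε`: on every input `x` in the domain of `f`, the output
of `A` is `f x` with probability at least `1 - ε`. -/
def RandAlg.Computes (A : RandAlg X ι) (ε : ℝ≥0∞) (f : PartialFn X ι) : Prop :=
  ∀ (x : ι → X) (b : Bool), b ∈ f x → 1 - ε ≤ (A.map fun T => T.eval x) b

/-- Worst-case randomized query complexity with error `ε`: the number of queries is maximized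
over all trees in the support of the algorithm and all inputs in the domain of `f`. -/
def R (ε : ℝ≥0∞) (f : PartialFn X ι) : ℝ≥0∞ :=
  ⨅ (A : RandAlg X ι) (_ : A.Computes ε f),
    ⨆ (T : DecTree X ι) (_ : T ∈ A.support) (x : ι → X) (_ : (f x).Dom), (T.cost x : ℝ≥0∞)

/-- Expected randomized query complexity with error `ε`: the expected number of queries is
maximized over all inputs in the domain of `f`. -/
def Rbar (ε : ℝ≥0∞) (f : PartialFn X ι) : ℝ≥0∞ :=
  ⨅ (A : RandAlg X ι) (_ : A.Computes ε f), ⨆ (x : ι → X) (_ : (f x).Dom), A.expCost x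

/-- Zero-error expected randomized query complexity. -/
def R0 (f : PartialFn X ι) : ℝ≥0∞ := Rbar 0 f

end Complexity

/-- The alphabet of sabotaged inputs: the two bits, the asterisk and the obelisk. -/
inductive Sym : Type
  | bit (b : Bool) : Sym
  | star : Sym
  | dagger : Sym

/-- The strings over the bits and the mark `s` that are consistent both with a `0`-input and with
a `1`-input of `f`. It is used for `s = star` and `s = dagger`. -/
def sabSet {ι : Type v} (f : PartialFn Bool ι) (s : Sym) : Set (ι → Sym) :=
  {q | (∀ i, q i = s ∨ ∃ b, q i = Sym.bit b) ∧
    ∃ x y : ι → Bool, false ∈ f x ∧ true ∈ f y ∧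
      ∀ i b, q i = Sym.bit b → x i = b ∧ y i = b}

open Classical in
/-- The sabotage problem of `f`: it is defined on the strings that are sabotaged by asterisks only
or by obelisks only, with value `0` in the first case and `1` in the second. (The two cases exclude
each other, since a sabotaged string has at least one mark.) -/
def sab {ι : Type v} (f : PartialFn Bool ι) : PartialFn Sym ι := fun q =>
  ⟨q ∈ sabSet f Sym.star ∨ q ∈ sabSet f Sym.dagger, fun _ => decide (q ∈ sabSet f Sym.dagger)⟩

/-- Randomized sabotage complexity. -/
def RS {ι : Type v} (f : PartialFn Bool ι) : ℝ≥0∞ := R0 (sab f)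

/-- The composition `f ∘ g`. An input is a family of inputs of `g` indexed by the positions of `f`;
it is in the domain if each of them is in the domain of `g` and the string of their values is in
the domain of `f`. -/
def comp {ι : Type v} {κ : Type w} (f : PartialFn Bool ι) (g : PartialFn Bool κ) :
    PartialFn Bool (ι × κ) := fun x =>
  Part.bind ⟨∀ i, (g fun j => x (i, j)).Dom, fun h i => (g fun j => x (i, j)).get (h i)⟩ f

/-- The positions of the inputs of the `n`-fold iterate of a function with positions `ι`. -/
def IterIdx (ι : Type v) : ℕ → Type v
  | 0 => PUnit
  | 1 => ι
  | n + 2 => ι × IterIdx ι (n + 1)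

/-- The `n`-fold composition of `f` with itself: `f¹ = f` and `fⁱ⁺¹ = f ∘ fⁱ` for `i ≥ 1`
(and, by convention, `f⁰` is the identity on one bit). -/
def iter {ι : Type v} (f : PartialFn Bool ι) : (n : ℕ) → PartialFn Bool (IterIdx ι n)
  | 0 => fun x => Part.some (x PUnit.unit)
  | 1 => f
  | n + 2 => comp f (iter f (n + 1))

end Sabotage

end

/-!
A sabotage problem is solved by finding a mark, so `RS f` is the cost of a search for a mark. A
search is a decision tree on bits that is run on a sabotaged input until it reads a mark
(`DecTree.hits`, `DecTree.findCost`); it may give up. Every randomized search whose expected cost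
is at most `r` times its success probability, with the latter bounded away from zero, yields
`RS f ≤ r` (`RS_le_of_search`). Both inequalities rest on this fact.

For the composition, `RS_le_of_search` and the separation theorem for convex sets give, for each
`r < RS g`, a distribution `D` of sabotaged inputs of `g` on which each search costs at least `r`
times its success probability (`exists_hard_distribution`). Let `A` solve the sabotage problem of
`comp f g`. To solve that of `f` on the input `q`, draw for each position `i` a block from `D`
independently, and run `A` on the input whose block `i` is the `i`-th sample with its marks
replaced according to `q i`: by the symbols of a `0`-input or a `1`-input of `g` that is
consistent with the sample if `q i` is a bit, and by `q i` itself if it is a mark. The symbol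
`q i` has to be queried only when `A` reads a marked position of the `i`-th sample
(`DecTree.simulate`). With the other blocks fixed, the queries of `A` in block `i` up to this
point are a search on an input from `D` (`DecTree.project`). So `A` makes, in expectation, at
least `r` times as many queries in the block as the simulation makes to `q i`, and summing over
`i` yields `r * RS f ≤ RS (comp f g)`.

For the bounded-error inequality, an algorithm with error `1/3` that is run on a sabotaged input
finds a mark with probability at least `1/3`, because it tells apart a `0`-input and a `1`-input
that agree off the marks. Hence `RS f ≤ 3 * R (1/3) f` by `RS_le_of_search` (`RS_le_three_mul_R`),
which is applied to the iterates of `f`.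
-/

noncomputable section

namespace Sabotage

universe u v w

/-! ### Expected cost and zero-error algorithms -/

section RandAlg

variable {X : Type u} {ι : Type v}

theorem RandAlg.expCost_pure (T : DecTree X ι) (x : ι → X) :
    RandAlg.expCost (PMF.pure T) x = T.cost x := by
  unfold RandAlg.expCost
  rw [tsum_eq_single T]
  · simp
  · intro S hS
    simp [PMF.pure_apply, hS]

theorem RandAlg.expCost_bind {α : Type*} (p : PMF α) (F : α → RandAlg X ι) (x : ι → X) :
    RandAlg.expCost (p.bind F) x = ∑' a, p a * RandAlg.expCost (F a) x := by
  unfold RandAlg.expCost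
  simp_rw [PMF.bind_apply, ← ENNReal.tsum_mul_right, ← ENNReal.tsum_mul_left]
  rw [ENNReal.tsum_comm]
  simp_rw [mul_assoc]

theorem RandAlg.computes_zero_iff (A : RandAlg X ι) (f : PartialFn X ι) :
    RandAlg.Computes A 0 f ↔ ∀ x b, b ∈ f x → ∀ T ∈ A.support, T.eval x = b := by
  unfold RandAlg.Computes
  refine forall_congr' fun x => forall_congr' fun b => imp_congr_right fun _ => ?_
  rw [tsub_zero, (PMF.coe_le_one _ _).ge_iff_eq, PMF.apply_eq_one_iff]
  constructor
  · intro h T hT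
    have : T.eval x ∈ (A.map fun T => T.eval x).support :=
      (PMF.mem_support_map_iff _ _ _).2 ⟨T, hT, rfl⟩
    rw [h] at this
    exact this
  · intro h
    obtain ⟨T, hT⟩ := A.support_nonempty
    ext c
    rw [PMF.mem_support_map_iff]
    constructor
    · rintro ⟨S, hS, rfl⟩
      exact h S hS
    · rintro rfl
      exact ⟨T, hT, h T hT⟩

/-- An average of numbers, all of which are at most `c`, is at most `c`. -/
theorem tsum_pmf_mul_le {α : Type*} (p : PMF α) (φ : α → ℝ≥0∞) (c : ℝ≥0∞)
    (h : ∀ a ∈ p.support, φ a ≤ c) : ∑' a, p a * φ a ≤ c := by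
  calc ∑' a, p a * φ a ≤ ∑' a, p a * c := by
        refine ENNReal.tsum_le_tsum fun a => ?_
        by_cases ha : p a = 0
        · simp [ha]
        · gcongr
          exact h a ((PMF.mem_support_iff _ _).2 ha)
    _ = c := by rw [ENNReal.tsum_mul_right, PMF.tsum_coe, one_mul]

end RandAlg

/-! ### The sabotage problem -/

section Sab

variable {ι : Type v}

/-- The mark that makes the sabotage problem take the value `b`. -/
def mark : Bool → Sym
  | false => Sym.star
  | true => Sym.dagger

theorem mark_ne_bit (b c : Bool) : mark b ≠ Sym.bit c := by
  cases b <;> simp [mark]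

theorem mem_sabSet_mark_unique {f : PartialFn Bool ι} {q : ι → Sym} {b c : Bool}
    (hb : q ∈ sabSet f (mark b)) (hc : q ∈ sabSet f (mark c)) : b = c := by
  by_contra hbc
  obtain ⟨hb, x, y, hx, hy, hxy⟩ := hb
  have hbit : ∀ i, ∃ b, q i = Sym.bit b := by
    intro i
    rcases hb i with h | h
    · rcases hc.1 i with h' | h'
      · rw [h] at h'
        cases b <;> cases c <;> simp_all [mark]
      · exact h'
    · exact h
  have : x = y := by
    funext i
    obtain ⟨b, h⟩ := hbit i
    rw [(hxy i b h).1, (hxy i b h).2]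
  subst this
  exact Bool.false_ne_true (Part.mem_unique hx hy)

theorem mem_sab_iff {f : PartialFn Bool ι} {q : ι → Sym} {b : Bool} :
    b ∈ sab f q ↔ q ∈ sabSet f (mark b) := by
  classical
  constructor
  · rintro ⟨h, rfl⟩
    by_cases hd : q ∈ sabSet f Sym.dagger
    · simp [sab, hd, mark]
    · have h' : q ∈ sabSet f Sym.star := h.resolve_right hd
      simpa [sab, hd, mark] using h'
  · intro h
    have hdom : q ∈ sabSet f Sym.star ∨ q ∈ sabSet f Sym.dagger := by
      cases b
      · exact Or.inl h
      · exact Or.inr h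
    refine ⟨hdom, ?_⟩
    cases b
    · have : q ∉ sabSet f Sym.dagger := fun h' =>
        Bool.false_ne_true (mem_sabSet_mark_unique (b := false) (c := true) h h')
      simpa [sab] using this
    · simpa [sab, mark] using h

theorem dom_sab_iff {f : PartialFn Bool ι} {q : ι → Sym} :
    (sab f q).Dom ↔ ∃ b, q ∈ sabSet f (mark b) := by
  rw [Part.dom_iff_mem]
  exact exists_congr fun b => mem_sab_iff

/-- To compute `sab f` it suffices to find a mark, since all marks of an input are equal. -/
theorem eq_mark_of_ne_bit {f : PartialFn Bool ι} {q : ι → Sym} {b : Bool}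
    (h : q ∈ sabSet f (mark b)) {i : ι} (hi : ∀ c, q i ≠ Sym.bit c) : q i = mark b :=
  (h.1 i).resolve_right fun ⟨c, hc⟩ => hi c hc

theorem RS_le {f : PartialFn Bool ι} {c : ℝ≥0∞} (A : RandAlg Sym ι)
    (hA : ∀ b, ∀ q ∈ sabSet f (mark b), ∀ T ∈ A.support, T.eval q = b)
    (hc : ∀ b, ∀ q ∈ sabSet f (mark b), RandAlg.expCost A q ≤ c) : RS f ≤ c := by
  refine iInf₂_le_of_le A ((RandAlg.computes_zero_iff A _).2 ?_) (iSup₂_le fun q hq => ?_)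
  · intro q b hb
    exact hA b q (mem_sab_iff.1 hb)
  · obtain ⟨b, hb⟩ := dom_sab_iff.1 hq
    exact hc b q hb

theorem exists_of_RS_lt {f : PartialFn Bool ι} {c : ℝ≥0∞} (h : RS f < c) :
    ∃ A : RandAlg Sym ι, (∀ b, ∀ q ∈ sabSet f (mark b), ∀ T ∈ A.support, T.eval q = b) ∧
      ∀ b, ∀ q ∈ sabSet f (mark b), RandAlg.expCost A q ≤ c := by
  unfold RS R0 Rbar at h
  simp only [iInf_lt_iff] at h
  obtain ⟨A, hA, h⟩ := h
  refine ⟨A, fun b q hq => (RandAlg.computes_zero_iff A _).1 hA q b (mem_sab_iff.2 hq), ?_⟩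
  intro b q hq
  exact (le_iSup₂ (f := fun q (_ : (sab f q).Dom) => RandAlg.expCost A q) q
    (dom_sab_iff.2 ⟨b, hq⟩)).trans h.le

end Sab

/-! ### Searching for a mark -/

namespace DecTree

variable {ι : Type v}

/-- Regard a decision tree on bits as a search for a mark: it is run on a string of bits and marks
until it reads a mark or arrives at a leaf. This says whether it reads a mark. -/
def hits : DecTree Bool ι → (ι → Sym) → Bool
  | leaf _, _ => false
  | query i next, q =>
    match q i with
    | Sym.bit b => hits (next b) q
    | _ => true

/-- The number of queries of a decision tree that is run as a search for a mark, the query that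
finds the mark included. -/
def findCost : DecTree Bool ι → (ι → Sym) → ℕ
  | leaf _, _ => 0
  | query i next, q =>
    match q i with
    | Sym.bit b => findCost (next b) q + 1
    | _ => 1

/-- Search for a mark with `T`; if a mark is found, output the value for which it stands, and if
the search ends without a mark, continue with `S`. -/
def searchThen : DecTree Bool ι → DecTree Sym ι → DecTree Sym ι
  | leaf _, S => S
  | query i next, S => query i fun s =>
    match s with
    | Sym.bit b => searchThen (next b) S
    | Sym.star => leaf false
    | Sym.dagger => leaf true

theorem cost_searchThen (T : DecTree Bool ι) (S : DecTree Sym ι) (q : ι → Sym) :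
    (searchThen T S).cost q = T.findCost q + if T.hits q then 0 else S.cost q := by
  induction T with
  | leaf b => simp [searchThen, findCost, hits]
  | query i next ih =>
    rcases h : q i with b | _ | _
    · simp only [searchThen, cost, findCost, hits, h, ih]
      omega
    · simp [searchThen, cost, findCost, hits, h]
    · simp [searchThen, cost, findCost, hits, h]

theorem eval_searchThen {f : PartialFn Bool ι} {q : ι → Sym} {b : Bool}
    (hq : q ∈ sabSet f (mark b)) (T : DecTree Bool ι) (S : DecTree Sym ι)
    (hS : T.hits q = false → S.eval q = b) : (searchThen T S).eval q = b := by
  induction T with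
  | leaf b => exact hS rfl
  | query i next ih =>
    rcases h : q i with c | _ | _
    · simp only [searchThen, eval, h]
      exact ih c fun h' => hS (by simpa [hits, h] using h')
    · have := eq_mark_of_ne_bit hq (i := i) (by simp [h])
      rw [h] at this
      cases b <;> simp [searchThen, eval, h, mark] at this ⊢
    · have := eq_mark_of_ne_bit hq (i := i) (by simp [h])
      rw [h] at this
      cases b <;> simp [searchThen, eval, h, mark] at this ⊢

/-- Query the positions in a list one after the other. -/
def queryList : List ι → DecTree Bool ι
  | [] => leaf false
  | i :: l => query i fun _ => queryList l

theorem findCost_queryList_le (l : List ι) (q : ι → Sym) :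
    (queryList l).findCost q ≤ l.length := by
  induction l with
  | nil => simp [queryList, findCost]
  | cons i l ih => rcases h : q i with b | _ | _ <;> simp [queryList, findCost, h, ih]

theorem exists_eq_bit_of_not_hits_queryList (l : List ι) (q : ι → Sym)
    (h : (queryList l).hits q = false) : ∀ i ∈ l, ∃ b, q i = Sym.bit b := by
  induction l with
  | nil => simp
  | cons i l ih => rcases hi : q i with b | _ | _ <;> simp_all [queryList, hits]

end DecTree

section Search

variable {ι : Type v}

theorem exists_mark {f : PartialFn Bool ι} {q : ι → Sym} {b : Bool}
    (h : q ∈ sabSet f (mark b)) : ∃ i, ∀ c, q i ≠ Sym.bit c := by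
  by_contra! hbit
  have h' : q ∈ sabSet f (mark !b) := ⟨fun i => Or.inr (hbit i), h.2⟩
  have := mem_sabSet_mark_unique h h'
  cases b <;> simp at this

theorem RS_ne_top [Finite ι] (f : PartialFn Bool ι) : RS f ≠ ⊤ := by
  have := Fintype.ofFinite ι
  let l : List ι := Finset.univ.toList
  refine ne_top_of_le_ne_top (ENNReal.natCast_ne_top l.length)
    (RS_le (PMF.pure ((DecTree.queryList l).searchThen (DecTree.leaf false))) ?_ ?_)
  · intro b q hq T hT
    rw [PMF.support_pure, Set.mem_singleton_iff] at hT
    subst hT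
    refine DecTree.eval_searchThen hq _ _ fun hh => ?_
    obtain ⟨i, hi⟩ := exists_mark hq
    obtain ⟨c, hc⟩ := DecTree.exists_eq_bit_of_not_hits_queryList l q hh i (by simp [l])
    exact absurd hc (hi c)
  · intro b q hq
    rw [RandAlg.expCost_pure, DecTree.cost_searchThen]
    simpa [DecTree.cost] using DecTree.findCost_queryList_le l q

/-- If a randomized search finds a mark with positive probability and its expected cost is at most
`r` times that probability, then `RS f ≤ r`. One could repeat the search until it succeeds. Instead,
run it once and continue with a nearly optimal algorithm upon failure: were `r < RS f`, this would
beat the optimum. -/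
theorem RS_le_of_search [Finite ι] (f : PartialFn Bool ι) {α : Type*} (p : PMF α)
    (T : α → DecTree Bool ι) (r s₀ : ℝ≥0∞) (hs₀ : s₀ ≠ 0)
    (h : ∀ b, ∀ q ∈ sabSet f (mark b),
      ∑' a, p a * ((T a).findCost q : ℝ≥0∞) ≤ r * ∑' a, p a * (if (T a).hits q then 1 else 0) ∧
      s₀ ≤ ∑' a, p a * (if (T a).hits q then 1 else 0)) : RS f ≤ r := by
  by_cases hdom : ∃ b q, q ∈ sabSet f (mark b)
  swap
  · push Not at hdom
    exact (RS_le (PMF.pure (DecTree.leaf false)) (fun b q hq => absurd hq (hdom b q))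
      (fun b q hq => absurd hq (hdom b q))).trans (zero_le (a := r))
  by_contra! hr
  have hc : RS f ≠ ⊤ := RS_ne_top f
  have hone : ∀ q : ι → Sym, (∑' a, p a * (if (T a).hits q then 1 else 0)) +
      (∑' a, p a * (if (T a).hits q then 0 else 1)) = (1 : ℝ≥0∞) := by
    intro q
    rw [← ENNReal.tsum_add, ← p.tsum_coe]
    refine tsum_congr fun a => ?_
    split_ifs <;> simp
  have hs₀1 : s₀ ≤ 1 := by
    obtain ⟨b, q, hq⟩ := hdom
    exact (h b q hq).2.trans ((le_add_right le_rfl).trans (hone q).le)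
  have hs₀t : s₀ ≠ ⊤ := ne_top_of_le_ne_top ENNReal.one_ne_top hs₀1
  -- The continuation costs at most `K`, and `r < K`, so the least success probability is the worst
  -- case: the combined algorithm costs at most `r * s₀ + (1 - s₀) * K`.
  have key : ∀ K, RS f < K → RS f ≤ r * s₀ + (1 - s₀) * K := by
    intro K hK
    obtain ⟨B, hB, hBK⟩ := exists_of_RS_lt hK
    refine RS_le (p.bind fun a => B.bind fun S => PMF.pure ((T a).searchThen S)) ?_ ?_
    · intro b q hq U hU
      simp only [PMF.mem_support_bind_iff, PMF.support_pure, Set.mem_singleton_iff] at hU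
      obtain ⟨a, -, S, hS, rfl⟩ := hU
      exact DecTree.eval_searchThen hq _ _ fun _ => hB b q hq S hS
    · intro b q hq
      set s : ℝ≥0∞ := ∑' a, p a * (if (T a).hits q then 1 else 0) with hs
      set t : ℝ≥0∞ := ∑' a, p a * (if (T a).hits q then 0 else 1) with ht
      have hstep : RandAlg.expCost (p.bind fun a => B.bind fun S =>
          PMF.pure ((T a).searchThen S)) q ≤ r * s + t * K := by
        calc RandAlg.expCost (p.bind fun a => B.bind fun S => PMF.pure ((T a).searchThen S)) q
            ≤ ∑' a, p a * ((T a).findCost q + (if (T a).hits q then 0 else 1) * K) := by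
              rw [RandAlg.expCost_bind]
              refine ENNReal.tsum_le_tsum fun a => ?_
              gcongr
              rw [RandAlg.expCost_bind]
              simp_rw [RandAlg.expCost_pure, DecTree.cost_searchThen]
              by_cases hh : (T a).hits q
              · simp only [hh, if_true, add_zero, zero_mul]
                rw [ENNReal.tsum_mul_right, PMF.tsum_coe, one_mul]
              · simp only [hh, if_false, Nat.cast_add, mul_add, one_mul, Bool.false_eq_true]
                rw [ENNReal.tsum_add, ENNReal.tsum_mul_right, PMF.tsum_coe, one_mul]
                gcongr
                exact hBK b q hq
          _ = ∑' a, p a * ((T a).findCost q : ℝ≥0∞) + t * K := by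
              simp_rw [mul_add, ← mul_assoc]
              rw [ENNReal.tsum_add, ENNReal.tsum_mul_right]
          _ ≤ r * s + t * K := by
              gcongr
              exact (h b q hq).1
      refine hstep.trans ?_
      obtain ⟨d, hd⟩ := exists_add_of_le (h b q hq).2
      rw [← hs] at hd
      have ht' : 1 - s₀ = d + t := by
        refine ENNReal.sub_eq_of_eq_add_rev hs₀t ?_
        rw [← add_assoc, ← hd]
        exact (hone q).symm
      rw [ht', hd]
      calc r * (s₀ + d) + t * K = r * s₀ + (d * r + t * K) := by ring
        _ ≤ r * s₀ + (d * K + t * K) := by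
            gcongr
            exact (hr.trans hK).le
        _ = r * s₀ + (d + t) * K := by ring
  have hle : RS f ≤ r * s₀ + (1 - s₀) * RS f := by
    refine ENNReal.le_of_forall_pos_le_add fun ε hε _ => ?_
    refine (key (RS f + ε) (ENNReal.lt_add_right hc (by simpa using hε.ne'))).trans ?_
    rw [mul_add, add_assoc]
    gcongr
    exact mul_le_of_le_one_left (zero_le (a := (ε : ℝ≥0∞))) tsub_le_self
  -- Since `RS f` is finite, `(1 - s₀) * RS f` cancels, which leaves `RS f * s₀ ≤ r * s₀`.
  have hsplit : RS f = RS f * s₀ + (1 - s₀) * RS f := by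
    rw [mul_comm (RS f) s₀, ← add_mul, add_tsub_cancel_of_le hs₀1, one_mul]
  have hfin : (1 - s₀) * RS f ≠ ⊤ :=
    ENNReal.mul_ne_top (ne_top_of_le_ne_top ENNReal.one_ne_top tsub_le_self) hc
  have : RS f * s₀ ≤ r * s₀ := by
    rw [← ENNReal.add_le_add_iff_right hfin, ← hsplit]
    exact hle
  exact hr.not_ge ((ENNReal.mul_le_mul_iff_left hs₀ hs₀t).1 this)

end Search

/-! ### Hard distributions by minimax -/

section Minimax

/-- Minimax for a game with finitely many columns, as a theorem of the alternative: either some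
mixed row strategy has negative value against every column, or some mixed column strategy has
nonnegative value against every row. It is the separation of the convex hull of the rows from the
open negative orthant by a hyperplane. -/
theorem exists_convexHull_neg_or_exists_weights {P τ : Type*} [Fintype P] [Nonempty τ]
    (v : τ → P → ℝ) :
    (∃ a ∈ convexHull ℝ (Set.range v), ∀ p, a p < 0) ∨
      ∃ w : P → ℝ, (∀ p, 0 ≤ w p) ∧ ∑ p, w p = 1 ∧ ∀ t, 0 ≤ ∑ p, w p * v t p := by
  classical
  by_cases hC : ∃ a ∈ convexHull ℝ (Set.range v), ∀ p, a p < 0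
  · exact Or.inl hC
  right
  push Not at hC
  let N : Set (P → ℝ) := Set.univ.pi fun _ => Set.Iio 0
  obtain ⟨f, u, hN, hu⟩ := geometric_hahn_banach_open (s := N)
    (t := convexHull ℝ (Set.range v)) (convex_pi fun _ _ => convex_Iio 0)
    (isOpen_set_pi Set.finite_univ fun _ _ => isOpen_Iio) (convex_convexHull ℝ _)
    (Set.disjoint_left.2 fun a ha ha' => by
      obtain ⟨p, hp⟩ := hC a ha'
      exact hp.not_gt (ha p trivial))
  -- The orthant is a cone, so `f` is nonpositive on it and the separating level `u` is nonnegative.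
  have hscale : ∀ a : P → ℝ, (∀ p, a p < 0) → ∀ c : ℝ, 0 < c → c * f a < u := by
    intro a ha c hc
    have := hN (c • a) fun p _ => mul_neg_of_pos_of_neg hc (ha p)
    simpa using this
  have hneg : ∀ a : P → ℝ, (∀ p, a p < 0) → f a ≤ 0 := by
    intro a ha
    by_contra! hpos
    have h1 := hscale a ha ((|u| + 1) / f a) (by positivity)
    rw [div_mul_cancel₀ _ hpos.ne'] at h1
    linarith [le_abs_self u]
  have hu0 : 0 ≤ u := by
    by_contra! hu'
    have h0 := hneg (fun _ => -1) (fun _ => by norm_num)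
    have h1 := hscale (fun _ => -1) (fun _ => by norm_num)
      (-u / (2 * (1 + |f fun _ => -1|))) (by have := neg_pos.2 hu'; positivity)
    have h2 : -u / (2 * (1 + |f fun _ => -1|)) * |f fun _ => -1| ≤ -u / 2 := by
      rw [div_mul_eq_mul_div, div_le_div_iff₀ (by positivity) (by norm_num)]
      nlinarith [abs_nonneg (f fun _ => -1)]
    rw [abs_of_nonpos h0] at h1 h2
    linarith
  have hsum : ∀ a : P → ℝ, f a = ∑ p, f (Pi.single p 1) * a p := by
    intro a
    conv_lhs => rw [← Finset.univ_sum_single a]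
    rw [map_sum]
    refine Finset.sum_congr rfl fun p _ => ?_
    have : (Pi.single p (a p) : P → ℝ) = a p • Pi.single p 1 := by
      rw [← Pi.single_smul', smul_eq_mul, mul_one]
    rw [this, map_smul, smul_eq_mul, mul_comm]
  -- The negative of a coordinate vector is a limit of points of the open orthant.
  have hw : ∀ p, 0 ≤ f (Pi.single p 1) := by
    intro p
    have hlim : Filter.Tendsto (fun ε : ℝ => f (-Pi.single p 1 - fun _ => ε))
        (nhdsWithin 0 (Set.Ioi 0)) (nhds (f (-Pi.single p 1 - fun _ => 0))) := by
      refine (Continuous.tendsto ?_ 0).mono_left nhdsWithin_le_nhds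
      fun_prop
    have h0 : f (-Pi.single p 1 - fun _ => 0) ≤ 0 := by
      refine le_of_tendsto hlim ?_
      filter_upwards [self_mem_nhdsWithin] with ε hε
      refine hneg _ fun q => ?_
      have : (0 : ℝ) ≤ (Pi.single p 1 : P → ℝ) q := by
        by_cases hq : q = p
        · subst hq; simp
        · simp [hq]
      have hε' : 0 < ε := hε
      simp only [Pi.sub_apply, Pi.neg_apply]
      linarith
    have h1 : (-Pi.single p 1 - fun _ => 0 : P → ℝ) = -Pi.single p 1 := by
      funext q; simp
    rw [h1, map_neg] at h0
    linarith
  have hpos : 0 < ∑ p, f (Pi.single p 1) := by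
    refine lt_of_le_of_ne (Finset.sum_nonneg fun p _ => hw p) fun h => ?_
    have hz := (Finset.sum_eq_zero_iff_of_nonneg fun p _ => hw p).1 h.symm
    have hf : ∀ a, f a = 0 := fun a => by
      rw [hsum]
      exact Finset.sum_eq_zero fun p hp => by rw [hz p hp, zero_mul]
    have h1 := hN (fun _ => -1) fun p _ => by simp
    obtain ⟨t⟩ := ‹Nonempty τ›
    have h2 := hu _ (subset_convexHull ℝ _ ⟨t, rfl⟩)
    rw [hf] at h1 h2
    linarith
  refine ⟨fun p => f (Pi.single p 1) / ∑ p, f (Pi.single p 1),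
    fun p => div_nonneg (hw p) hpos.le, ?_, fun t => ?_⟩
  · rw [← Finset.sum_div, div_self hpos.ne']
  · simp_rw [div_mul_eq_mul_div]
    rw [← Finset.sum_div, ← hsum]
    exact div_nonneg (hu0.trans (hu _ (subset_convexHull ℝ _ ⟨t, rfl⟩))) hpos.le

theorem sum_ofReal_mul_natCast {α : Type*} [Fintype α] (w : α → ℝ) (hw : ∀ a, 0 ≤ w a)
    (n : α → ℕ) : ∑ a, ENNReal.ofReal (w a) * (n a : ℝ≥0∞) = ENNReal.ofReal (∑ a, w a * n a) := by
  rw [ENNReal.ofReal_sum_of_nonneg fun a _ => mul_nonneg (hw a) (Nat.cast_nonneg _)]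
  refine Finset.sum_congr rfl fun a _ => ?_
  rw [ENNReal.ofReal_mul (hw a), ENNReal.ofReal_natCast]

/-- The probability distribution with given real weights on a finite type. -/
def pmfOfWeights {α : Type*} [Fintype α] (w : α → ℝ) (hw : ∀ a, 0 ≤ w a) (h : ∑ a, w a = 1) :
    PMF α :=
  PMF.ofFintype (fun a => ENNReal.ofReal (w a)) (by
    rw [← ENNReal.ofReal_sum_of_nonneg fun a _ => hw a, h, ENNReal.ofReal_one])

/-- The sabotaged inputs of `f`, with either mark. -/
abbrev Sabotaged {ι : Type v} (f : PartialFn Bool ι) : Type v :=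
  {q : ι → Sym // ∃ b, q ∈ sabSet f (mark b)}

instance : Finite Sym :=
  Finite.of_surjective (fun o : Option (Option Bool) => match o with
    | none => Sym.star
    | some none => Sym.dagger
    | some (some b) => Sym.bit b) (by
      rintro (b | _ | _)
      · exact ⟨some (some b), rfl⟩
      · exact ⟨none, rfl⟩
      · exact ⟨some none, rfl⟩)

/-- A hard distribution: for each `r < RS g` there is a distribution of sabotaged inputs on which
every search for a mark costs at least `r` times its probability of success. This includes searches
that may give up, which is more than hardness for algorithms that always succeed. -/
theorem exists_hard_distribution {κ : Type v} [Finite κ] (g : PartialFn Bool κ)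
    [Fintype (Sabotaged g)] (r : NNReal) (hr : (r : ℝ≥0∞) < RS g) :
    ∃ D : PMF (Sabotaged g), ∀ T : DecTree Bool κ,
      r * ∑ p, D p * (if T.hits p.1 then 1 else 0) ≤ ∑ p, D p * (T.findCost p.1 : ℝ≥0∞) := by
  have : Nonempty (DecTree Bool κ) := ⟨DecTree.leaf false⟩
  let h : DecTree Bool κ → Sabotaged g → ℕ := fun T p => if T.hits p.1 then 1 else 0
  have hh : ∀ (T : DecTree Bool κ) (p : Sabotaged g),
      (if T.hits p.1 then 1 else 0 : ℝ≥0∞) = (h T p : ℕ) := by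
    intro T p
    simp only [h]
    split_ifs <;> simp
  rcases exists_convexHull_neg_or_exists_weights
    (fun (T : DecTree Bool κ) (p : Sabotaged g) => (T.findCost p.1 : ℝ) - r * (h T p : ℕ))
    with ⟨a, ha, hneg⟩ | ⟨w, hw, hw1, hT⟩
  · exfalso
    obtain ⟨α, _, w, z, hw, hw1, hz, hsum⟩ := mem_convexHull_iff_exists_fintype.1 ha
    choose T hT using hz
    have hval : ∀ p, a p = ∑ i, w i * (T i).findCost p.1 - r * ∑ i, w i * (h (T i) p : ℕ) := by
      intro p
      rw [← hsum, Finset.sum_apply, Finset.mul_sum, ← Finset.sum_sub_distrib]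
      refine Finset.sum_congr rfl fun i _ => ?_
      rw [← hT i]
      simp only [Pi.smul_apply, smul_eq_mul]
      ring
    have hc0 : ∀ p : Sabotaged g, 0 ≤ ∑ i, w i * ((T i).findCost p.1 : ℝ) := fun p =>
      Finset.sum_nonneg fun i _ => mul_nonneg (hw i) (Nat.cast_nonneg _)
    have hs0 : ∀ p : Sabotaged g, 0 ≤ ∑ i, w i * (h (T i) p : ℝ) := fun p =>
      Finset.sum_nonneg fun i _ => mul_nonneg (hw i) (Nat.cast_nonneg _)
    have hspos : ∀ p : Sabotaged g, 0 < ∑ i, w i * (h (T i) p : ℝ) := by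
      intro p
      refine lt_of_le_of_ne (hs0 p) fun h0 => ?_
      have := hneg p
      rw [hval, ← h0] at this
      linarith [hc0 p]
    -- There are finitely many sabotaged inputs, hence a positive bound that serves for all.
    obtain ⟨s₀, hs₀, hle⟩ : ∃ s₀ : ℝ, 0 < s₀ ∧
        ∀ p : Sabotaged g, s₀ ≤ ∑ i, w i * (h (T i) p : ℝ) := by
      rcases isEmpty_or_nonempty (Sabotaged g) with he | hne
      · exact ⟨1, one_pos, fun p => he.elim p⟩
      · obtain ⟨p₀, hp₀⟩ := Finite.exists_min
          fun p : Sabotaged g => ∑ i, w i * (h (T i) p : ℝ)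
        exact ⟨_, hspos p₀, hp₀⟩
    refine hr.not_ge (RS_le_of_search g (pmfOfWeights w hw hw1) T r (ENNReal.ofReal s₀)
      (by simpa using hs₀) fun b q hq => ?_)
    let p : Sabotaged g := ⟨q, b, hq⟩
    have e1 : ∑' i, pmfOfWeights w hw hw1 i * ((T i).findCost q : ℝ≥0∞) =
        ENNReal.ofReal (∑ i, w i * (T i).findCost q) := by
      rw [tsum_fintype]
      exact sum_ofReal_mul_natCast w hw _
    have e2 : ∑' i, pmfOfWeights w hw hw1 i * (if (T i).hits q then 1 else 0) =
        ENNReal.ofReal (∑ i, w i * (h (T i) p : ℕ)) := by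
      rw [tsum_fintype, ← sum_ofReal_mul_natCast w hw]
      exact Finset.sum_congr rfl fun i _ => by rw [← hh]; rfl
    rw [e1, e2]
    refine ⟨?_, ENNReal.ofReal_le_ofReal (hle p)⟩
    rw [← ENNReal.ofReal_coe_nnreal, ← ENNReal.ofReal_mul r.coe_nonneg]
    refine ENNReal.ofReal_le_ofReal ?_
    have := hneg p
    rw [hval] at this
    linarith
  · refine ⟨pmfOfWeights w hw hw1, fun T => ?_⟩
    have e1 : ∑ p, pmfOfWeights w hw hw1 p * (T.findCost p.1 : ℝ≥0∞) =
        ENNReal.ofReal (∑ p, w p * T.findCost p.1) :=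
      sum_ofReal_mul_natCast w hw fun p => T.findCost p.1
    have e2 : ∑ p, pmfOfWeights w hw hw1 p * (if T.hits p.1 then 1 else 0) =
        ENNReal.ofReal (∑ p, w p * (h T p : ℕ)) := by
      rw [← sum_ofReal_mul_natCast w hw]
      exact Finset.sum_congr rfl fun p _ => by rw [← hh]; rfl
    rw [e1, e2, ← ENNReal.ofReal_coe_nnreal, ← ENNReal.ofReal_mul r.coe_nonneg]
    refine ENNReal.ofReal_le_ofReal ?_
    have := hT T
    simp_rw [mul_sub] at this
    rw [Finset.sum_sub_distrib] at this
    rw [Finset.mul_sum]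
    have e3 : ∑ p, w p * (r * (h T p : ℝ)) = ∑ p, r * (w p * (h T p : ℝ)) :=
      Finset.sum_congr rfl fun p _ => by ring
    linarith

end Minimax

/-! ### Bounded-error algorithms find marks -/

namespace DecTree

variable {ι : Type v}

theorem findCost_le_cost (T : DecTree Bool ι) {q : ι → Sym} {x : ι → Bool}
    (hx : ∀ i b, q i = Sym.bit b → x i = b) : T.findCost q ≤ T.cost x := by
  induction T with
  | leaf b => simp [findCost]
  | query i next ih =>
    rcases h : q i with b | _ | _
    · simp only [findCost, cost, h, hx i b h]
      exact Nat.succ_le_succ (ih b)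
    · simp [findCost, cost, h]
    · simp [findCost, cost, h]

/-- A tree that outputs different values on two inputs reads a position where they differ, so it
finds a mark when it is run on a string that is consistent with both. -/
theorem eval_eq_eval_of_not_hits (T : DecTree Bool ι) {q : ι → Sym} {x y : ι → Bool}
    (hxy : ∀ i b, q i = Sym.bit b → x i = b ∧ y i = b) (hT : T.hits q = false) :
    T.eval x = T.eval y := by
  induction T with
  | leaf b => rfl
  | query i next ih =>
    rcases h : q i with b | _ | _
    · simp only [eval, (hxy i b h).1, (hxy i b h).2]
      exact ih b (by simpa [hits, h] using hT)
    · simp [hits, h] at hT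
    · simp [hits, h] at hT

end DecTree

theorem pmf_map_apply_eq_tsum {α : Type*} (p : PMF α) (e : α → Bool) (b : Bool) :
    (p.map e) b = ∑' a, p a * (if e a = b then 1 else 0) := by
  rw [PMF.map_apply]
  refine tsum_congr fun a => ?_
  by_cases h : e a = b
  · simp [h]
  · simp [h, Ne.symm h]

/-- An algorithm with error `1/3` finds a mark with probability at least `1/3` when it is
run on a sabotaged input: with probability at least `1 - 2/3` it is correct on both a `0`-input
and a `1`-input that are consistent with it. -/
theorem RS_le_three_mul_R {ι : Type v} [Finite ι] (f : PartialFn Bool ι) :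
    RS f ≤ 3 * R (1 / 3) f := by
  unfold R
  simp only [ENNReal.mul_iInf_of_ne (by norm_num : (3 : ℝ≥0∞) ≠ 0) (by norm_num)]
  refine le_iInf₂ fun A hA => ?_
  set d : ℝ≥0∞ := ⨆ (T : DecTree Bool ι) (_ : T ∈ A.support) (x : ι → Bool) (_ : (f x).Dom),
    (T.cost x : ℝ≥0∞) with hd
  refine RS_le_of_search f A id (3 * d) (1 / 3) (by norm_num) fun b q hq => ?_
  obtain ⟨-, x, y, hx, hy, hxy⟩ := hq
  have hcost : ∑' T, A T * (T.findCost q : ℝ≥0∞) ≤ d := by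
    refine tsum_pmf_mul_le A _ d fun T hT => ?_
    have h1 : (T.findCost q : ℝ≥0∞) ≤ T.cost x := by
      exact_mod_cast T.findCost_le_cost fun i b h => (hxy i b h).1
    refine h1.trans ?_
    rw [hd]
    exact le_iSup₂_of_le T hT (le_iSup₂_of_le x (Part.dom_iff_mem.2 ⟨_, hx⟩) le_rfl)
  have hhit : 1 / 3 ≤ ∑' T, A T * (if T.hits q then 1 else 0) := by
    have h0 := hA x false hx
    have h1 := hA y true hy
    rw [pmf_map_apply_eq_tsum] at h0 h1
    have hle : (1 - 1 / 3) + (1 - 1 / 3) ≤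
        1 + ∑' T, A T * (if T.hits q then 1 else 0 : ℝ≥0∞) := by
      refine (add_le_add h0 h1).trans ?_
      rw [← A.tsum_coe, ← ENNReal.tsum_add, ← ENNReal.tsum_add]
      refine ENNReal.tsum_le_tsum fun T => ?_
      have := T.eval_eq_eval_of_not_hits hxy
      cases hh : T.hits q <;> cases he : T.eval x <;> cases he' : T.eval y <;>
        simp_all
    have h3 : (1 : ℝ≥0∞) = 1 / 3 + 1 / 3 + 1 / 3 := (ENNReal.add_thirds 1).symm
    have h23 : (1 - 1 / 3 : ℝ≥0∞) = 1 / 3 + 1 / 3 := ENNReal.sub_eq_of_eq_add (by norm_num) h3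
    have h43 : (1 - 1 / 3 : ℝ≥0∞) + (1 - 1 / 3) = 1 + 1 / 3 := by
      rw [h23, ← add_assoc, ← h3]
    rw [h43] at hle
    exact (ENNReal.add_le_add_iff_left ENNReal.one_ne_top).1 hle
  refine ⟨hcost.trans ?_, hhit⟩
  calc d = 3 * d * (1 / 3) := by
        rw [mul_comm 3 d, mul_assoc, ENNReal.mul_div_cancel (by norm_num) (by norm_num), mul_one]
    _ ≤ _ := by gcongr; exact hhit

/-! ### Independent samples -/

section Product

variable {ι : Type*} {α : Type*} [Fintype ι] [DecidableEq ι] [Fintype α]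

/-- The distribution of a family of independent samples from `D`. -/
def iidPMF (ι : Type*) {α : Type*} [Fintype ι] [DecidableEq ι] [Fintype α] (D : PMF α) :
    PMF (ι → α) :=
  PMF.ofFintype (fun P => ∏ i, D (P i)) (by
    have h : ∑ a, D a = 1 := (tsum_fintype _).symm.trans D.tsum_coe
    rw [← Fintype.prod_sum fun (_ : ι) a => D a]
    simp [h])

/-- Sampling one member of an independent family again does not change the distribution. -/
theorem sum_iidPMF_mul_update (D : PMF α) (i : ι) (φ : (ι → α) → ℝ≥0∞) :
    ∑ P, iidPMF ι D P * φ P =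
      ∑ P, iidPMF ι D P * ∑ a, D a * φ (Function.update P i a) := by
  have hD : ∑ a, D a = 1 := (tsum_fintype _).symm.trans D.tsum_coe
  let e := Equiv.funSplitAt i α
  have hi : ∀ x : α × ({j // j ≠ i} → α), e.symm x i = x.1 := fun x =>
    congrArg Prod.fst (e.apply_symm_apply x)
  have hj : ∀ (x : α × ({j // j ≠ i} → α)) (j : {j // j ≠ i}), e.symm x j = x.2 j := fun x j =>
    congrFun (congrArg Prod.snd (e.apply_symm_apply x)) j
  have hW : ∀ x, iidPMF ι D (e.symm x) = D x.1 * ∏ j, D (x.2 j) := by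
    intro x
    change ∏ k, D (e.symm x k) = _
    rw [Fintype.prod_eq_mul_prod_subtype_ne _ i, hi]
    simp_rw [hj]
  have hup : ∀ x a, Function.update (e.symm x) i a = e.symm (a, x.2) := by
    intro x a
    funext k
    by_cases hk : k = i
    · subst hk
      rw [Function.update_self, hi]
    · rw [Function.update_of_ne hk, hj x ⟨k, hk⟩, hj (a, x.2) ⟨k, hk⟩]
  rw [← e.symm.sum_comp, ← e.symm.sum_comp]
  simp_rw [hW, hup]
  rw [Fintype.sum_prod_type_right, Fintype.sum_prod_type_right]
  refine Finset.sum_congr rfl fun P _ => ?_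
  simp_rw [mul_assoc]
  rw [← Finset.sum_mul, hD, one_mul, Finset.mul_sum]
  refine Finset.sum_congr rfl fun a _ => ?_
  ring

end Product

/-! ### Filling blocks and simulating an algorithm for the composition -/

section Compose

variable {ι : Type v} {κ : Type w}

/-- The block that stands for the symbol `s`: the sabotaged string `p` in which the marks are
replaced, by the symbols of `z b` if `s` is the bit `b`, and by `s` if it is a mark. -/
def fill (p : κ → Sym) (z : Bool → κ → Bool) (s : Sym) (j : κ) : Sym :=
  match p j with
  | Sym.bit b => Sym.bit b
  | _ =>
    match s with
    | Sym.bit c => Sym.bit (z c j)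
    | _ => s

theorem fill_of_eq_bit {p : κ → Sym} (z : Bool → κ → Bool) (s : Sym) {j : κ} {b : Bool}
    (h : p j = Sym.bit b) : fill p z s j = Sym.bit b := by
  simp [fill, h]

theorem mem_comp_iff {f : PartialFn Bool ι} {g : PartialFn Bool κ} {x : ι × κ → Bool} {b : Bool} :
    b ∈ comp f g x ↔ ∃ a : ι → Bool, (∀ i, a i ∈ g fun j => x (i, j)) ∧ b ∈ f a := by
  unfold comp
  rw [Part.mem_bind_iff]
  constructor
  · rintro ⟨a, ⟨h, rfl⟩, hb⟩
    exact ⟨_, fun i => Part.get_mem (h i), hb⟩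
  · rintro ⟨a, ha, hb⟩
    refine ⟨a, ⟨fun i => Part.dom_iff_mem.2 ⟨_, ha i⟩, ?_⟩, hb⟩
    funext i
    exact Part.get_eq_of_mem (ha i) _

/-- Replacing the symbols of a sabotaged input of `f` by blocks gives a sabotaged input of
`comp f g` with the same mark. -/
theorem fill_mem_sabSet {f : PartialFn Bool ι} {g : PartialFn Bool κ} {b : Bool} {q : ι → Sym}
    (hq : q ∈ sabSet f (mark b)) (P : ι → κ → Sym) (z : ι → Bool → κ → Bool)
    (hz : ∀ i c, c ∈ g (z i c)) (hP : ∀ i c j d, P i j = Sym.bit d → z i c j = d) :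
    (fun ij : ι × κ => fill (P ij.1) (z ij.1) (q ij.1) ij.2) ∈ sabSet (comp f g) (mark b) := by
  obtain ⟨hq, x, y, hx, hy, hxy⟩ := hq
  refine ⟨fun ⟨i, j⟩ => ?_, fun ij => z ij.1 (x ij.1) ij.2, fun ij => z ij.1 (y ij.1) ij.2,
    mem_comp_iff.2 ⟨x, fun i => hz i (x i), hx⟩, mem_comp_iff.2 ⟨y, fun i => hz i (y i), hy⟩, ?_⟩
  · rcases hPi : P i j with c | _ | _ <;> rcases hq i with h | ⟨c, h⟩ <;>
      cases b <;> simp [fill, hPi, h, mark]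
  · rintro ⟨i, j⟩ d hd
    dsimp only at hd ⊢
    rcases hPi : P i j with c | _ | _
    · rw [fill_of_eq_bit _ _ hPi] at hd
      cases hd
      exact ⟨hP _ _ _ _ hPi, hP _ _ _ _ hPi⟩
    all_goals
      rcases hqi : q i with c | _ | _
      · have hc := hxy i c hqi
        simp only [fill, hPi, hqi, Sym.bit.injEq] at hd
        rw [hc.1, hc.2]
        exact ⟨hd, hd⟩
      · simp [fill, hPi, hqi] at hd
      · simp [fill, hPi, hqi] at hd

namespace DecTree

variable [DecidableEq ι]

/-- The search for a mark in block `i` that `T` performs when the other blocks are those of `Q`. -/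
def project (i : ι) : DecTree Sym (ι × κ) → (ι × κ → Sym) → DecTree Bool κ
  | leaf b, _ => leaf b
  | query ij next, Q =>
    if ij.1 = i then query ij.2 fun b => project i (next (Sym.bit b)) Q
    else project i (next (Q ij)) Q

theorem project_congr (i : ι) (T : DecTree Sym (ι × κ)) {Q Q' : ι × κ → Sym}
    (h : ∀ ij : ι × κ, ij.1 ≠ i → Q ij = Q' ij) : project i T Q = project i T Q' := by
  induction T with
  | leaf b => rfl
  | query ij next ih =>
    by_cases hi : ij.1 = i
    · simp [project, hi, ih]
    · simp [project, hi, ih, h ij hi]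

theorem sum_findCost_project_le [Fintype ι] (T : DecTree Sym (ι × κ)) {Q : ι × κ → Sym}
    {P : ι → κ → Sym} (hQ : ∀ i j b, P i j = Sym.bit b → Q (i, j) = Sym.bit b) :
    ∑ i, (project i T Q).findCost (P i) ≤ T.cost Q := by
  induction T with
  | leaf b => simp [project, findCost]
  | query ij next ih =>
    obtain ⟨i, j⟩ := ij
    have hstep : ∀ k, (project k (query (i, j) next) Q).findCost (P k) ≤
        (project k (next (Q (i, j))) Q).findCost (P k) + if i = k then 1 else 0 := by
      intro k
      by_cases hk : i = k
      · subst hk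
        rcases hP : P i j with c | _ | _
        · simp [project, findCost, hP, hQ i j c hP]
        · simp [project, findCost, hP]
        · simp [project, findCost, hP]
      · simp [project, hk]
    calc ∑ k, (project k (query (i, j) next) Q).findCost (P k)
        ≤ ∑ k, ((project k (next (Q (i, j))) Q).findCost (P k) + if i = k then 1 else 0) :=
          Finset.sum_le_sum fun k _ => hstep k
      _ = ∑ k, (project k (next (Q (i, j))) Q).findCost (P k) + 1 := by
          rw [Finset.sum_add_distrib]
          simp
      _ ≤ (query (i, j) next).cost Q := Nat.succ_le_succ (ih _)

/-- Simulate `T` on an input whose blocks are filled in according to the symbols of the actual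
input. Symbol `i` is queried only when `T` reads a position of block `i` that is marked in `P i`;
`known` records the symbols that have been queried. -/
def simulate (P : ι → κ → Sym) (z : ι → Bool → κ → Bool) :
    DecTree Sym (ι × κ) → (ι → Option Sym) → DecTree Sym ι
  | leaf b, _ => leaf b
  | query ij next, known =>
    match P ij.1 ij.2 with
    | Sym.bit b => simulate P z (next (Sym.bit b)) known
    | _ =>
      match known ij.1 with
      | some s => simulate P z (next (fill (P ij.1) (z ij.1) s ij.2)) known
      | none => query ij.1 fun s =>
          simulate P z (next (fill (P ij.1) (z ij.1) s ij.2)) (Function.update known ij.1 (some s))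

theorem eval_simulate (P : ι → κ → Sym) (z : ι → Bool → κ → Bool) (q : ι → Sym)
    (T : DecTree Sym (ι × κ)) (known : ι → Option Sym) (hk : ∀ i s, known i = some s → q i = s) :
    (simulate P z T known).eval q = T.eval fun ij => fill (P ij.1) (z ij.1) (q ij.1) ij.2 := by
  induction T generalizing known with
  | leaf b => rfl
  | query ij next ih =>
    obtain ⟨i, j⟩ := ij
    rcases hP : P i j with c | _ | _
    · simp [simulate, eval, hP, ih _ known hk, fill_of_eq_bit _ _ hP]
    all_goals
      rcases hi : known i with _ | s
      · have hk' : ∀ k s, Function.update known i (some (q i)) k = some s → q k = s := by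
          intro k s h
          by_cases hki : k = i
          · subst hki
            simpa using h
          · rw [Function.update_of_ne hki] at h
            exact hk k s h
        simp [simulate, eval, hP, hi, ih _ _ hk']
      · simp [simulate, eval, hP, hi, ih _ known hk, hk i s hi]

theorem cost_simulate_le [Fintype ι] (P : ι → κ → Sym) (z : ι → Bool → κ → Bool) (q : ι → Sym)
    (T : DecTree Sym (ι × κ)) (known : ι → Option Sym) (hk : ∀ i s, known i = some s → q i = s) :
    (simulate P z T known).cost q ≤ ∑ i, if known i = none ∧ (project i T fun ij =>
      fill (P ij.1) (z ij.1) (q ij.1) ij.2).hits (P i) then 1 else 0 := by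
  induction T generalizing known with
  | leaf b => simp [simulate, cost]
  | query ij next ih =>
    obtain ⟨i, j⟩ := ij
    rcases hP : P i j with c | _ | _
    · have hc : simulate P z (query (i, j) next) known = simulate P z (next (Sym.bit c)) known := by
        simp [simulate, hP]
      rw [hc]
      refine (ih _ known hk).trans (Finset.sum_le_sum fun k _ => ?_)
      by_cases hki : i = k
      · subst hki
        simp [project, hits, hP]
      · simp [project, hki, fill_of_eq_bit _ _ hP]
    all_goals
      rcases hi : known i with _ | s
      · have hk' : ∀ k s, Function.update known i (some (q i)) k = some s → q k = s := by
          intro k s h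
          by_cases hki : k = i
          · subst hki
            simpa using h
          · rw [Function.update_of_ne hki] at h
            exact hk k s h
        have hc : (simulate P z (query (i, j) next) known).cost q =
            (simulate P z (next (fill (P i) (z i) (q i) j))
              (Function.update known i (some (q i)))).cost q + 1 := by
          simp [simulate, cost, hP, hi]
        rw [hc]
        refine (Nat.succ_le_succ (ih _ _ hk')).trans ?_
        rw [Nat.succ_eq_add_one, ← Finset.add_sum_erase _ _ (Finset.mem_univ i),
          ← Finset.add_sum_erase _ _ (Finset.mem_univ i), add_comm]
        refine add_le_add ?_ ?_
        · simp [project, hits, hP, hi]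
        · simp only [Function.update_self, reduceCtorEq, false_and, if_false, zero_add]
          refine Finset.sum_le_sum fun k hki => ?_
          have hki' : k ≠ i := Finset.ne_of_mem_erase hki
          simp [project, Function.update_of_ne hki', hki'.symm]
      · have hc : simulate P z (query (i, j) next) known =
            simulate P z (next (fill (P i) (z i) s j)) known := by
          simp [simulate, hP, hi]
        rw [hc]
        refine (ih _ known hk).trans (Finset.sum_le_sum fun k _ => ?_)
        by_cases hki : i = k
        · subst hki
          simp [hi]
        · simp [project, hki, hk i s hi]

end DecTree

end Compose

/-! ### The composition theorem -/

section Composition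

variable {ι : Type v} {κ : Type w}

/-- An expectation over inputs with independent hard blocks: block by block, the simulation of `T`
queries a symbol only if the search that `T` performs in the block succeeds, and such a search is
costly whatever the contents of the other blocks are. -/
theorem mul_sum_cost_simulate_le [Fintype ι] [DecidableEq ι] {g : PartialFn Bool κ}
    [Fintype (Sabotaged g)] (D : PMF (Sabotaged g)) (r : ℝ≥0∞)
    (hD : ∀ T : DecTree Bool κ,
      r * ∑ p, D p * (if T.hits p.1 then 1 else 0) ≤ ∑ p, D p * (T.findCost p.1 : ℝ≥0∞))
    (z : Sabotaged g → Bool → κ → Bool) (T : DecTree Sym (ι × κ)) (q : ι → Sym) :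
    r * ∑ P, iidPMF ι D P *
        (((T.simulate (fun i => (P i).1) (fun i => z (P i)) fun _ => none).cost q : ℕ) : ℝ≥0∞) ≤
      ∑ P, iidPMF ι D P *
        ((T.cost fun ij => fill (P ij.1).1 (z (P ij.1)) (q ij.1) ij.2 : ℕ) : ℝ≥0∞) := by
  let Q : (ι → Sabotaged g) → ι × κ → Sym :=
    fun P ij => fill (P ij.1).1 (z (P ij.1)) (q ij.1) ij.2
  -- The search in block `i` does not depend on the sample for block `i`.
  have hup : ∀ P i p, DecTree.project i T (Q (Function.update P i p)) =
      DecTree.project i T (Q P) := by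
    intro P i p
    refine DecTree.project_congr i T fun ij hij => ?_
    simp only [Q, Function.update_of_ne hij]
  have hblock : ∀ i, r * ∑ P, iidPMF ι D P *
        (if (DecTree.project i T (Q P)).hits (P i).1 then 1 else 0) ≤
      ∑ P, iidPMF ι D P * ((DecTree.project i T (Q P)).findCost (P i).1 : ℝ≥0∞) := by
    intro i
    rw [sum_iidPMF_mul_update D i fun P =>
        if (DecTree.project i T (Q P)).hits (P i).1 then 1 else 0,
      sum_iidPMF_mul_update D i fun P => ((DecTree.project i T (Q P)).findCost (P i).1 : ℝ≥0∞),
      Finset.mul_sum]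
    refine Finset.sum_le_sum fun P _ => ?_
    simp_rw [hup, Function.update_self]
    rw [mul_left_comm]
    gcongr
    exact hD _
  calc r * ∑ P, iidPMF ι D P *
        (((T.simulate (fun i => (P i).1) (fun i => z (P i)) fun _ => none).cost q : ℕ) : ℝ≥0∞)
      ≤ r * ∑ P, iidPMF ι D P *
          ∑ i, (if (DecTree.project i T (Q P)).hits (P i).1 then 1 else 0) := by
        gcongr with P
        have := T.cost_simulate_le (fun i => (P i).1) (fun i => z (P i)) q (fun _ => none)
          (by simp)
        simp only [true_and] at this
        exact_mod_cast this
    _ = ∑ i, r * ∑ P, iidPMF ι D P *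
          (if (DecTree.project i T (Q P)).hits (P i).1 then 1 else 0) := by
        simp_rw [Finset.mul_sum]
        rw [Finset.sum_comm]
    _ ≤ ∑ i, ∑ P, iidPMF ι D P * ((DecTree.project i T (Q P)).findCost (P i).1 : ℝ≥0∞) :=
        Finset.sum_le_sum fun i _ => hblock i
    _ = ∑ P, iidPMF ι D P * ∑ i, ((DecTree.project i T (Q P)).findCost (P i).1 : ℝ≥0∞) := by
        simp_rw [Finset.mul_sum]
        rw [Finset.sum_comm]
    _ ≤ ∑ P, iidPMF ι D P * (T.cost (Q P) : ℝ≥0∞) := by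
        gcongr with P
        exact_mod_cast T.sum_findCost_project_le (Q := Q P) (P := fun i => (P i).1)
          fun i j b h => fill_of_eq_bit _ _ h

theorem RS_mul_RS_le [Finite ι] [Finite κ] (f : PartialFn Bool ι) (g : PartialFn Bool κ) :
    RS f * RS g ≤ RS (comp f g) := by
  classical
  have := Fintype.ofFinite ι
  have := Fintype.ofFinite (Sabotaged g)
  refine ENNReal.mul_le_of_forall_lt fun a ha r' hr' => ?_
  lift r' to NNReal using hr'.ne_top with r
  refine (mul_le_mul_left ha.le _).trans ?_
  obtain ⟨D, hD⟩ := exists_hard_distribution g r hr'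
  have hex : ∀ (p : Sabotaged g) (c : Bool), ∃ z : κ → Bool, c ∈ g z ∧
      ∀ j d, p.1 j = Sym.bit d → z j = d := by
    rintro ⟨p, b, -, x, y, hx, hy, hxy⟩ (_ | _)
    · exact ⟨x, hx, fun j d h => (hxy j d h).1⟩
    · exact ⟨y, hy, fun j d h => (hxy j d h).2⟩
  choose z hz hzP using hex
  rcases eq_or_ne r 0 with rfl | hr0
  · simp
  have hr0' : (r : ℝ≥0∞) ≠ 0 := by simpa using hr0
  refine le_of_forall_gt_imp_ge_of_dense fun c hc => ?_
  obtain ⟨A, hA, hAc⟩ := exists_of_RS_lt hc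
  let q' : (ι → Sym) → (ι → Sabotaged g) → ι × κ → Sym :=
    fun q P ij => fill (P ij.1).1 (z (P ij.1)) (q ij.1) ij.2
  have hq' : ∀ b, ∀ q ∈ sabSet f (mark b), ∀ P, q' q P ∈ sabSet (comp f g) (mark b) :=
    fun b q hq P => fill_mem_sabSet hq (fun i => (P i).1) (fun i => z (P i))
      (fun i c => hz (P i) c) (fun i c => hzP (P i) c)
  rw [← ENNReal.le_div_iff_mul_le (Or.inl hr0') (Or.inl ENNReal.coe_ne_top)]
  refine RS_le (A.bind fun T => (iidPMF ι D).bind fun P => PMF.pure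
    (T.simulate (fun i => (P i).1) (fun i => z (P i)) fun _ => none)) ?_ ?_
  · intro b q hq U hU
    simp only [PMF.mem_support_bind_iff, PMF.support_pure, Set.mem_singleton_iff] at hU
    obtain ⟨T, hT, P, -, rfl⟩ := hU
    rw [DecTree.eval_simulate _ _ q _ _ (by simp)]
    exact hA b _ (hq' b q hq P) T hT
  · intro b q hq
    rw [ENNReal.le_div_iff_mul_le (Or.inl hr0') (Or.inl ENNReal.coe_ne_top), mul_comm]
    simp_rw [RandAlg.expCost_bind, RandAlg.expCost_pure, tsum_fintype]
    calc (r : ℝ≥0∞) * ∑' T, A T * ∑ P, iidPMF ι D P *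
          (((T.simulate (fun i => (P i).1) (fun i => z (P i)) fun _ => none).cost q : ℕ) : ℝ≥0∞)
        ≤ ∑' T, A T * ∑ P, iidPMF ι D P * ((T.cost (q' q P) : ℕ) : ℝ≥0∞) := by
          rw [← ENNReal.tsum_mul_left]
          refine ENNReal.tsum_le_tsum fun T => ?_
          rw [mul_left_comm]
          gcongr
          exact mul_sum_cost_simulate_le D r hD z T q
      _ = ∑' P, iidPMF ι D P * RandAlg.expCost A (q' q P) := by
          simp_rw [← tsum_fintype (L := .unconditional _), RandAlg.expCost,
            ← ENNReal.tsum_mul_left]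
          rw [ENNReal.tsum_comm]
          simp_rw [mul_left_comm]
      _ ≤ c := tsum_pmf_mul_le _ _ c fun P _ => hAc b _ (hq' b q hq P)

end Composition

/-! ### Iterated compositions -/

section Iterate

variable {ι : Type v}

instance finite_iterIdx [Finite ι] : ∀ n, Finite (IterIdx ι n)
  | 0 => inferInstanceAs (Finite PUnit)
  | 1 => inferInstanceAs (Finite ι)
  | n + 2 =>
    have := finite_iterIdx (n + 1)
    inferInstanceAs (Finite (ι × IterIdx ι (n + 1)))

theorem RS_pow_le_RS_iter [Finite ι] (f : PartialFn Bool ι) (n : ℕ) :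
    RS f ^ (n + 1) ≤ RS (iter f (n + 1)) := by
  induction n with
  | zero => rw [zero_add, pow_one]; exact le_rfl
  | succ n ih =>
    rw [pow_succ']
    exact (mul_le_mul_right ih _).trans (RS_mul_RS_le f (iter f (n + 1)))

end Iterate

end Sabotage

end

theorem mainTheorem3 {ι κ : Type*} [Finite ι] [Finite κ]
    (f : Sabotage.PartialFn Bool ι) (g : Sabotage.PartialFn Bool κ) :
    Sabotage.RS f * Sabotage.RS g ≤ Sabotage.RS (Sabotage.comp f g) ∧
      ∀ n : ℕ, 1 ≤ n → Sabotage.RS f ^ n / 3 ≤ Sabotage.R (1 / 3) (Sabotage.iter f n) := by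
  refine ⟨Sabotage.RS_mul_RS_le f g, fun n hn => ?_⟩
  obtain ⟨m, rfl⟩ := Nat.exists_eq_add_of_le' hn
  refine ENNReal.div_le_of_le_mul' ?_
  exact (Sabotage.RS_pow_le_RS_iter f m).trans (Sabotage.RS_le_three_mul_R _)
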